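/- Let $n\ge 1$, and write $B_R(x_0)$ for the open ball in $\mathbb{R}^n$ with the Euclidean norm and $B_R=B_R(0)$. Let $C^{1,1}(B_1)$ be the space of differentiable functions $b:B_1\to\mathbb{R}$ with finite norm $\|b\|_{C^2}:=\sup_{B_1}|b|+\sup_{B_1}|\nabla b|+\mathrm{Lip}_{B_1}(\nabla b)$, where $\mathrm{Lip}_{B_1}(\nabla b)$ is the Lipschitz constant of $\nabla b$ on $B_1$, i.e. the essential supremum of $|\nabla^2 b|$ (operator norm). For $b_0,b_1\in C^{1,1}(B_1)$ set $b_{10}:=b_1-b_0$, let $$b_{\mathrm{env}}:=\sup\{f : f \text{ subharmonic on } B_1,\ f\le\min\{b_0,b_1\}\}$$ (pointwise supremum) be the subharmonic envelope, and let $\Lambda:=\{x\in B_1 : b_{\mathrm{env}}(x)=\min\{b_0,b_1\}(x)\}$ be its contact set. Then there is a constant $C(n)>0$ depending only on $n$ such that for all $b_0,b_1\in C^{1,1}(B_1)$, with $$C:=\frac{C(n)}{1+\|b_0\|_{C^2}+\|b_1\|_{C^2}},$$ one has for every $x_0\in B_{1/2}$ with $b_{10}(x_0)=0$ $$\Lambda\cap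 B_{C|\nabla b_{10}(x_0)|}(x_0)=\emptyset .$$ -/

import Mathlib

open Metric
open scoped ENNReal

noncomputable section

namespace Rooftop

/-- The `C²` norm on a convex open set `Ω ⊆ ℝⁿ` in its `C^{1,1}` form:
`sup |b| + sup |∇b| + Lip (∇b)`, with values in `[0, ∞]`. On a convex open set the Lipschitz
constant of `∇b` is the (essential) supremum of the operator norm of the second derivative `∇²b`.
(The quotient is `0 / 0 = 0` for `x = y`.) -/
def c2Norm {n : ℕ} (Ω : Set (EuclideanSpace ℝ (Fin n))) (b : EuclideanSpace ℝ (Fin n) → ℝ) :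
    ℝ≥0∞ :=
  (⨆ x ∈ Ω, ‖b x‖ₑ) + (⨆ x ∈ Ω, ‖gradient b x‖ₑ) +
    ⨆ x ∈ Ω, ⨆ y ∈ Ω, edist (gradient b x) (gradient b y) / edist x y

/-- `b ∈ C^{1,1}(Ω)`, for `Ω` open and convex: `b` is differentiable on `Ω` and its `C²` norm
is finite. -/
def IsC11On {n : ℕ} (Ω : Set (EuclideanSpace ℝ (Fin n))) (b : EuclideanSpace ℝ (Fin n) → ℝ) :
    Prop :=
  DifferentiableOn ℝ b Ω ∧ c2Norm Ω b ≠ ⊤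

/-- Subharmonic functions `f : Ω → [-∞, ∞)` on a connected open set `Ω ⊆ ℝⁿ`: `f` is upper
semicontinuous, not identically `-∞`, and on every closed ball contained in `Ω` it lies below
every function that is continuous on the closed ball, harmonic in its interior, and at least `f`
on the boundary sphere. -/
structure IsSubharmonicOn {n : ℕ} (Ω : Set (EuclideanSpace ℝ (Fin n)))
    (f : EuclideanSpace ℝ (Fin n) → EReal) : Prop where
  upperSemicontinuousOn : UpperSemicontinuousOn f Ω
  lt_top : ∀ x ∈ Ω, f x < ⊤
  exists_ne_bot : ∃ x ∈ Ω, f x ≠ ⊥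
  le_harmonic : ∀ (c : EuclideanSpace ℝ (Fin n)) (r : ℝ), 0 < r → closedBall c r ⊆ Ω →
    ∀ h : EuclideanSpace ℝ (Fin n) → ℝ, ContinuousOn h (closedBall c r) →
      InnerProductSpace.HarmonicOnNhd h (ball c r) →
      (∀ x ∈ sphere c r, f x ≤ (h x : EReal)) → ∀ x ∈ closedBall c r, f x ≤ (h x : EReal)

/-- The subharmonic envelope on `Ω` of the rooftop obstacle `min {b₀, b₁}`: the pointwise supremum
of all subharmonic functions on `Ω` that lie below `min {b₀, b₁}` on `Ω`. -/
def envelope {n : ℕ} (Ω : Set (EuclideanSpace ℝ (Fin n)))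
    (b₀ b₁ : EuclideanSpace ℝ (Fin n) → ℝ) (x : EuclideanSpace ℝ (Fin n)) : EReal :=
  sSup {t : EReal | ∃ f : EuclideanSpace ℝ (Fin n) → EReal,
    IsSubharmonicOn Ω f ∧ (∀ y ∈ Ω, f y ≤ ((min (b₀ y) (b₁ y) : ℝ) : EReal)) ∧ t = f x}

/-- The contact set of the envelope with the rooftop obstacle `min {b₀, b₁}`. -/
def contactSet {n : ℕ} (Ω : Set (EuclideanSpace ℝ (Fin n)))
    (b₀ b₁ : EuclideanSpace ℝ (Fin n) → ℝ) : Set (EuclideanSpace ℝ (Fin n)) :=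
  {x | x ∈ Ω ∧ envelope Ω b₀ b₁ x = ((min (b₀ x) (b₁ x) : ℝ) : EReal)}

end Rooftop

end

/-! Near `x₀` the obstacle is, up to `N ‖ξ‖²` with `ξ = x - x₀`, an affine function plus the concave
wedge `min 0 ⟨p, ξ⟩`, where `p` is the gradient of `b₁ - b₀`. On a sphere of radius `r` the wedge
lies below a concave parabola in `⟨p, ξ⟩` (`min_zero_le_parabola`). Adding a multiple of `‖ξ‖² -
r²`, which vanishes on the sphere, makes the majorant harmonic and lowers its value at the centre by
`‖p‖ r / (2 n)`. For `r` a small multiple of `‖p‖ / (1 + N)` this beats the error `N r²`, so the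
envelope is strictly below the obstacle at `x₀`, and also nearby by the first order bounds
(`rooftop_gap`). -/

open InnerProductSpace Laplacian in
/-- The Laplacian of a quadratic polynomial `c + ⟨v, ξ⟩ + α ⟨p, ξ⟩² + β ‖ξ‖²`, `ξ = x - x₀`. -/
theorem Rooftop.laplacian_quadratic {n : ℕ} (x₀ v p : EuclideanSpace ℝ (Fin n)) (c α β : ℝ) :
    Δ (fun x : EuclideanSpace ℝ (Fin n) =>
      c + inner ℝ v (x - x₀) + α * inner ℝ p (x - x₀) ^ 2 + β * ‖x - x₀‖ ^ 2) =
      fun _ => 2 * α * ‖p‖ ^ 2 + 2 * n * β := by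
  have h₁ : ∀ x : EuclideanSpace ℝ (Fin n), HasFDerivAt (fun x : EuclideanSpace ℝ (Fin n) =>
      c + inner ℝ v (x - x₀) + α * inner ℝ p (x - x₀) ^ 2 + β * ‖x - x₀‖ ^ 2)
      (innerSL ℝ v + (2 * α * innerSL ℝ p (x - x₀)) • innerSL ℝ p
        + (2 * β) • innerSL ℝ (x - x₀)) x := by
    intro x
    have hid : HasFDerivAt (fun x : EuclideanSpace ℝ (Fin n) => x - x₀)
        (ContinuousLinearMap.id ℝ _) x := (hasFDerivAt_id x).sub_const x₀
    have hv := (innerSL ℝ v).hasFDerivAt.comp x hid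
    have hp := (innerSL ℝ p).hasFDerivAt.comp x hid
    have hn := hid.norm_sq
    refine (((hv.const_add c).add ((hp.pow 2).const_mul α)).add (hn.const_mul β)).congr_fderiv ?_
    ext w
    simp
    ring
  -- `innerSL ℝ` is typed as conjugate-linear; over `ℝ` it can be recast as a linear map, to which
  -- the derivative rules apply.
  obtain ⟨L, hL⟩ : ∃ L : EuclideanSpace ℝ (Fin n) →L[ℝ] EuclideanSpace ℝ (Fin n) →L[ℝ] ℝ,
      ∀ u, L u = innerSL ℝ u := ⟨innerSL ℝ, fun _ => rfl⟩
  have h₂ : ∀ x : EuclideanSpace ℝ (Fin n), HasFDerivAt (fun x : EuclideanSpace ℝ (Fin n) =>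
      innerSL ℝ v + (2 * α * innerSL ℝ p (x - x₀)) • innerSL ℝ p + (2 * β) • innerSL ℝ (x - x₀))
      (((2 * α) • innerSL ℝ p).smulRight (innerSL ℝ p) + (2 * β) • L) x := by
    intro x
    have hid : HasFDerivAt (fun x : EuclideanSpace ℝ (Fin n) => x - x₀)
        (ContinuousLinearMap.id ℝ _) x := (hasFDerivAt_id x).sub_const x₀
    have hp := ((innerSL ℝ p).hasFDerivAt.comp x hid).const_mul (2 * α)
    have hi := (L.hasFDerivAt.comp x hid).const_smul (2 * β)
    simp only [← hL (_ - x₀)]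
    refine (((hp.smul_const (innerSL ℝ p)).const_add (innerSL ℝ v)).add hi).congr_fderiv ?_
    ext u w
    simp [mul_assoc]
  rw [laplacian_eq_iteratedFDeriv_orthonormalBasis _ (EuclideanSpace.basisFun (Fin n) ℝ)]
  funext x
  simp_rw [iteratedFDeriv_two_apply, funext fun y => (h₁ y).fderiv, (h₂ x).fderiv]
  simp only [_root_.add_apply, ContinuousLinearMap.smulRight_apply,
    _root_.smul_apply, hL, innerSL_apply_apply, Matrix.cons_val_zero, Matrix.cons_val_one,
    smul_eq_mul, Finset.sum_add_distrib]
  have hp : ∑ i, 2 * α * inner ℝ p (EuclideanSpace.basisFun (Fin n) ℝ i)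
      * inner ℝ p (EuclideanSpace.basisFun (Fin n) ℝ i) = 2 * α * ‖p‖ ^ 2 := by
    rw [← (EuclideanSpace.basisFun (Fin n) ℝ).sum_sq_inner_left p, Finset.mul_sum]
    exact Finset.sum_congr rfl fun i _ => by ring
  rw [hp]
  simp
  ring

open InnerProductSpace in
/-- A quadratic polynomial whose second derivative has trace zero is harmonic. -/
theorem Rooftop.harmonicOnNhd_quadratic {n : ℕ} (x₀ v p : EuclideanSpace ℝ (Fin n)) (c α β : ℝ)
    (h : α * ‖p‖ ^ 2 + n * β = 0) (s : Set (EuclideanSpace ℝ (Fin n))) :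
    HarmonicOnNhd (fun x : EuclideanSpace ℝ (Fin n) =>
      c + inner ℝ v (x - x₀) + α * inner ℝ p (x - x₀) ^ 2 + β * ‖x - x₀‖ ^ 2) s := by
  intro x _
  refine ⟨?_, ?_⟩
  · have hid : ContDiffAt ℝ 2 (fun x : EuclideanSpace ℝ (Fin n) => x - x₀) x :=
      contDiffAt_id.sub contDiffAt_const
    exact ((contDiffAt_const.add (contDiffAt_const.inner ℝ hid)).add
      (contDiffAt_const.mul ((contDiffAt_const.inner ℝ hid).pow 2))).add
      (contDiffAt_const.mul (hid.norm_sq ℝ))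
  · rw [laplacian_quadratic]
    exact Filter.Eventually.of_forall fun _ => by simp only [Pi.zero_apply]; linarith

/-- A function with finite `C²` norm has gradient bounded by that norm. -/
theorem Rooftop.IsC11On.norm_gradient_le {n : ℕ} {Ω : Set (EuclideanSpace ℝ (Fin n))}
    {b : EuclideanSpace ℝ (Fin n) → ℝ} (hb : IsC11On Ω b) {x : EuclideanSpace ℝ (Fin n)}
    (hx : x ∈ Ω) : ‖gradient b x‖ ≤ (c2Norm Ω b).toReal := by
  have h : ‖gradient b x‖ₑ ≤ c2Norm Ω b :=
    (le_iSup₂ (f := fun x (_ : x ∈ Ω) => ‖gradient b x‖ₑ) x hx).trans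
      (le_add_self.trans le_self_add)
  simpa using ENNReal.toReal_mono hb.2 h

/-- The gradient of a `C^{1,1}` function is Lipschitz with constant its `C²` norm. -/
theorem Rooftop.IsC11On.dist_gradient_le {n : ℕ} {Ω : Set (EuclideanSpace ℝ (Fin n))}
    {b : EuclideanSpace ℝ (Fin n) → ℝ} (hb : IsC11On Ω b) {x y : EuclideanSpace ℝ (Fin n)}
    (hx : x ∈ Ω) (hy : y ∈ Ω) :
    dist (gradient b x) (gradient b y) ≤ (c2Norm Ω b).toReal * dist x y := by
  rcases eq_or_ne x y with rfl | hxy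
  · simp
  have h : edist (gradient b x) (gradient b y) / edist x y ≤ c2Norm Ω b :=
    (le_iSup₂ (f := fun y (_ : y ∈ Ω) => edist (gradient b x) (gradient b y) / edist x y)
      y hy).trans ((le_iSup₂ (f := fun x (_ : x ∈ Ω) => ⨆ y ∈ Ω,
        edist (gradient b x) (gradient b y) / edist x y) x hx).trans le_add_self)
  rw [ENNReal.div_le_iff (by simpa using hxy) (edist_ne_top _ _)] at h
  simpa [edist_dist, ENNReal.toReal_mul, ENNReal.toReal_ofReal] using
    ENNReal.toReal_mono (ENNReal.mul_ne_top hb.2 (edist_ne_top x y)) h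

/-- First order Taylor expansion of a `C^{1,1}` function on a convex open set. -/
theorem Rooftop.IsC11On.abs_sub_taylor_le {n : ℕ} {Ω : Set (EuclideanSpace ℝ (Fin n))}
    {b : EuclideanSpace ℝ (Fin n) → ℝ} (hb : IsC11On Ω b) (hΩ : IsOpen Ω) (hc : Convex ℝ Ω)
    {x y : EuclideanSpace ℝ (Fin n)} (hx : x ∈ Ω) (hy : y ∈ Ω) :
    |b y - b x - inner ℝ (gradient b x) (y - x)| ≤ (c2Norm Ω b).toReal * ‖y - x‖ ^ 2 := by
  have hd : ∀ z ∈ Ω, DifferentiableAt ℝ b z := fun z hz => (hb.1 z hz).differentiableAt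
    (hΩ.mem_nhds hz)
  have h := Convex.norm_image_sub_le_of_norm_fderiv_le' (𝕜 := ℝ) (f := b)
    (s := Ω ∩ closedBall x ‖y - x‖) (φ := fderiv ℝ b x) (x := x) (y := y)
    (C := (c2Norm Ω b).toReal * ‖y - x‖) (fun z hz => hd z hz.1) ?_
    (hc.inter (convex_closedBall _ _)) ⟨hx, by simp⟩ ⟨hy, by simp [dist_eq_norm]⟩
  · rw [← inner_gradient_left, Real.norm_eq_abs] at h
    linarith
  · intro z hz
    rw [← toDual_gradient, ← toDual_gradient, ← map_sub, LinearIsometryEquiv.norm_map,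
      ← dist_eq_norm]
    exact (hb.dist_gradient_le hz.1 hx).trans
      (mul_le_mul_of_nonneg_left (mem_closedBall.1 hz.2) ENNReal.toReal_nonneg)

/-- The envelope lies below every harmonic majorant of the obstacle on the boundary of a ball. -/
theorem Rooftop.envelope_le_of_harmonic {n : ℕ} {Ω : Set (EuclideanSpace ℝ (Fin n))}
    {b₀ b₁ h : EuclideanSpace ℝ (Fin n) → ℝ} {c : EuclideanSpace ℝ (Fin n)} {r : ℝ} (hr : 0 < r)
    (hΩ : closedBall c r ⊆ Ω) (hh : InnerProductSpace.HarmonicOnNhd h (closedBall c r))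
    (hb : ∀ x ∈ sphere c r, min (b₀ x) (b₁ x) ≤ h x) {y : EuclideanSpace ℝ (Fin n)}
    (hy : y ∈ closedBall c r) : envelope Ω b₀ b₁ y ≤ (h y : EReal) := by
  refine sSup_le ?_
  rintro _ ⟨f, hf, hfb, rfl⟩
  exact hf.le_harmonic c r hr hΩ h hh.continuousOn (hh.mono ball_subset_closedBall)
    (fun x hx => (hfb x (hΩ (sphere_subset_closedBall hx))).trans
      (EReal.coe_le_coe_iff.2 (hb x hx))) y hy

/-- If `|s| ≤ t`, then `min 0 s` lies below the parabola `s / 2 - s² / (2 t)`. -/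
theorem Rooftop.min_zero_le_parabola {s t : ℝ} (ht : 0 < t) (hs : |s| ≤ t) :
    min 0 s ≤ s / 2 - s ^ 2 / (2 * t) := by
  -- This suffices because `min 0 s = s / 2 - |s| / 2`.
  have h : s ^ 2 / (2 * t) ≤ |s| / 2 := by
    rw [div_le_div_iff₀ (by positivity) two_pos, ← sq_abs]
    nlinarith [abs_nonneg s]
  rcases le_total 0 s with hs' | hs'
  · rw [min_eq_left hs', abs_of_nonneg hs'] at *
    linarith
  · rw [min_eq_right hs', abs_of_nonpos hs'] at *
    linarith

/-- The gap at distance `d` from the rooftop edge: the harmonic majorant on the ball of radius `r`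
is strictly below the obstacle. -/
theorem Rooftop.rooftop_gap {m N P r d : ℝ} (hm : 1 ≤ m) (hN : 0 ≤ N) (hP : 0 < P)
    (hr : r = P / (8 * m * (1 + N))) (hd₀ : 0 ≤ d) (hd : d < r / (16 * m)) :
    P * d / 2 + P / (2 * m * r) * (d ^ 2 - r ^ 2) + N * r ^ 2 < -(P * d) - N * d ^ 2 := by
  have hm₀ : 0 < m := by linarith
  have hr₀ : 0 < r := by rw [hr]; positivity
  have hPr : 8 * m * (1 + N) * r = P := by rw [hr]; field_simp
  have hNr : 8 * m * (N * r) ≤ P := by nlinarith [mul_pos hm₀ hr₀]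
  have hdm : d * (16 * m) < r := by rwa [lt_div_iff₀ (by positivity)] at hd
  have hdr : 16 * d ≤ r := by nlinarith
  have hd2 : 256 * d ^ 2 ≤ r ^ 2 := by nlinarith
  -- All terms are compared in units of `P * r / m`; the claim becomes `1/8 + 1/2048 + (3/2)/16 <
  -- 255/512`.
  have h₁ : P / (2 * m * r) * (d ^ 2 - r ^ 2) ≤ -(P * r * (255 / 512) / m) := by
    have : d ^ 2 - r ^ 2 ≤ -(255 / 256) * r ^ 2 := by linarith
    calc P / (2 * m * r) * (d ^ 2 - r ^ 2) ≤ P / (2 * m * r) * (-(255 / 256) * r ^ 2) :=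
          mul_le_mul_of_nonneg_left this (by positivity)
      _ = _ := by field_simp; ring
  have h₂ : N * r ^ 2 ≤ P * r / 8 / m := by
    rw [le_div_iff₀ hm₀]
    nlinarith
  have h₃ : N * d ^ 2 ≤ P * r / 2048 / m := by
    have : N * d ^ 2 ≤ N * r ^ 2 / 256 := by nlinarith
    have e : P * r / 2048 / m = P * r / 8 / m / 256 := by ring
    linarith
  have h₄ : P * d ≤ P * r / 16 / m := by
    rw [le_div_iff₀ hm₀]
    nlinarith
  have h₅ : 0 < P * r / m := by positivity
  have e₁ : P * r * (255 / 512) / m = 255 / 512 * (P * r / m) := by ring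
  have e₂ : P * r / 8 / m = 1 / 8 * (P * r / m) := by ring
  have e₃ : P * r / 2048 / m = 1 / 2048 * (P * r / m) := by ring
  have e₄ : P * r / 16 / m = 1 / 16 * (P * r / m) := by ring
  linarith

theorem proposition4p4 (n : ℕ) (hn : 1 ≤ n) :
    ∃ C : ℝ, 0 < C ∧
      ∀ b₀ b₁ : EuclideanSpace ℝ (Fin n) → ℝ,
        Rooftop.IsC11On (ball 0 1) b₀ → Rooftop.IsC11On (ball 0 1) b₁ →
        ∀ x₀ ∈ ball (0 : EuclideanSpace ℝ (Fin n)) (1 / 2), b₁ x₀ - b₀ x₀ = 0 →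
          Rooftop.contactSet (ball 0 1) b₀ b₁ ∩
            ball x₀ (C / (1 + (Rooftop.c2Norm (ball 0 1) b₀).toReal
                + (Rooftop.c2Norm (ball 0 1) b₁).toReal)
              * ‖gradient (fun x => b₁ x - b₀ x) x₀‖) = ∅ := by
  have hn' : (1 : ℝ) ≤ n := by exact_mod_cast hn
  have hn₀ : (0 : ℝ) < n := by linarith
  -- `128 n² = 8 n · 16 n`: the excluded ball has radius `r / (16 n)` for the `r` chosen below.
  refine ⟨1 / (128 * n ^ 2), by positivity, fun b₀ b₁ hb₀ hb₁ x₀ hx₀ hx => ?_⟩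
  have hx₀' : x₀ ∈ ball (0 : EuclideanSpace ℝ (Fin n)) 1 := ball_subset_ball (by norm_num) hx₀
  have hgrad : gradient (fun x => b₁ x - b₀ x) x₀ = gradient b₁ x₀ - gradient b₀ x₀ := by
    have hd := fun {b : EuclideanSpace ℝ (Fin n) → ℝ} (hb : Rooftop.IsC11On (ball 0 1) b) =>
      (hb.1 x₀ hx₀').differentiableAt (isOpen_ball.mem_nhds hx₀')
    simp only [gradient, fderiv_fun_sub (hd hb₁) (hd hb₀), map_sub]
  have hg₀ := hb₀.norm_gradient_le hx₀'
  have hg₁ := hb₁.norm_gradient_le hx₀'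
  have ht₀ := fun {y : EuclideanSpace ℝ (Fin n)} (hy : y ∈ ball 0 1) =>
    abs_le.1 (hb₀.abs_sub_taylor_le isOpen_ball (convex_ball 0 1) hx₀' hy)
  have ht₁ := fun {y : EuclideanSpace ℝ (Fin n)} (hy : y ∈ ball 0 1) =>
    abs_le.1 (hb₁.abs_sub_taylor_le isOpen_ball (convex_ball 0 1) hx₀' hy)
  have hN₀ : 0 ≤ (Rooftop.c2Norm (ball 0 1) b₀).toReal := ENNReal.toReal_nonneg
  have hN₁ : 0 ≤ (Rooftop.c2Norm (ball 0 1) b₁).toReal := ENNReal.toReal_nonneg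
  rw [hgrad]
  generalize (Rooftop.c2Norm (ball 0 1) b₀).toReal = N₀ at *
  generalize (Rooftop.c2Norm (ball 0 1) b₁).toReal = N₁ at *
  generalize ha : gradient b₀ x₀ = a at *
  obtain ⟨p, hp⟩ : ∃ p, p = gradient b₁ x₀ - a := ⟨_, rfl⟩
  rw [← hp]
  obtain rfl | hp₀ := eq_or_ne p 0
  · simp
  have hP : 0 < ‖p‖ := norm_pos_iff.2 hp₀
  have hPN : ‖p‖ ≤ N₀ + N₁ := by
    rw [hp]
    linarith [norm_sub_le (gradient b₁ x₀) a]
  have hN : 0 ≤ N₀ + N₁ := by linarith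
  have hb₁₀ : b₁ x₀ = b₀ x₀ := by linarith
  have hupper : ∀ y ∈ ball (0 : EuclideanSpace ℝ (Fin n)) 1, min (b₀ y) (b₁ y) ≤
      b₀ x₀ + inner ℝ a (y - x₀) + min 0 (inner ℝ p (y - x₀)) + (N₀ + N₁) * ‖y - x₀‖ ^ 2 := by
    intro y hy
    have h₀ := (ht₀ hy).2
    have h₁ := (ht₁ hy).2
    have hi : inner ℝ p (y - x₀) = inner ℝ (gradient b₁ x₀) (y - x₀) - inner ℝ a (y - x₀) := by
      rw [hp, inner_sub_left]
    have hq₀ := mul_nonneg hN₀ (sq_nonneg ‖y - x₀‖)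
    have hq₁ := mul_nonneg hN₁ (sq_nonneg ‖y - x₀‖)
    rcases min_choice 0 (inner ℝ p (y - x₀)) with h | h <;> rw [h]
    · exact (min_le_left _ _).trans (by linarith)
    · exact (min_le_right _ _).trans (by linarith)
  have hlower : ∀ y ∈ ball (0 : EuclideanSpace ℝ (Fin n)) 1,
      b₀ x₀ + inner ℝ a (y - x₀) - ‖p‖ * ‖y - x₀‖ - (N₀ + N₁) * ‖y - x₀‖ ^ 2 ≤
        min (b₀ y) (b₁ y) := by
    intro y hy
    have h₀ := (ht₀ hy).1
    have h₁ := (ht₁ hy).1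
    have hi : inner ℝ p (y - x₀) = inner ℝ (gradient b₁ x₀) (y - x₀) - inner ℝ a (y - x₀) := by
      rw [hp, inner_sub_left]
    have hq₀ := mul_nonneg hN₀ (sq_nonneg ‖y - x₀‖)
    have hq₁ := mul_nonneg hN₁ (sq_nonneg ‖y - x₀‖)
    have hq := mul_nonneg hP.le (norm_nonneg (y - x₀))
    have hcs := (abs_le.1 (abs_real_inner_le_norm p (y - x₀))).1
    exact le_min (by linarith) (by linarith)
  -- The Taylor error `N r²` is then at most a quarter of the drop `‖p‖ r / (2 n)`, and `‖p‖ ≤ N₀ +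
  -- N₁` keeps the ball inside the unit ball.
  obtain ⟨r, hr⟩ : ∃ r, r = ‖p‖ / (8 * n * (1 + (N₀ + N₁))) := ⟨_, rfl⟩
  have hr₀ : 0 < r := by rw [hr]; positivity
  have hr₁ : r ≤ 1 / 2 := by
    rw [hr, div_le_iff₀ (by positivity)]
    nlinarith
  have hsub : closedBall x₀ r ⊆ ball (0 : EuclideanSpace ℝ (Fin n)) 1 :=
    closedBall_subset_ball' (by linarith [mem_ball.1 hx₀])
  have hh := Rooftop.harmonicOnNhd_quadratic x₀ (a + (1 / 2 : ℝ) • p) p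
    (b₀ x₀ - ‖p‖ / (2 * n * r) * r ^ 2 + (N₀ + N₁) * r ^ 2) (-(1 / (2 * (‖p‖ * r))))
    (‖p‖ / (2 * n * r)) (by field_simp; ring) (closedBall x₀ r)
  have hbd : ∀ x ∈ sphere x₀ r, min (b₀ x) (b₁ x) ≤
      b₀ x₀ - ‖p‖ / (2 * n * r) * r ^ 2 + (N₀ + N₁) * r ^ 2
        + inner ℝ (a + (1 / 2 : ℝ) • p) (x - x₀)
        + -(1 / (2 * (‖p‖ * r))) * inner ℝ p (x - x₀) ^ 2
        + ‖p‖ / (2 * n * r) * ‖x - x₀‖ ^ 2 := by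
    intro x hxs
    have hxr : ‖x - x₀‖ = r := by rw [← dist_eq_norm]; exact hxs
    have hu := hupper x (hsub (sphere_subset_closedBall hxs))
    have hm := Rooftop.min_zero_le_parabola (mul_pos hP hr₀)
      (hxr ▸ abs_real_inner_le_norm p (x - x₀))
    rw [inner_add_left, real_inner_smul_left]
    rw [hxr] at *
    rw [div_eq_mul_one_div (_ ^ 2)] at hm
    linarith
  refine Set.eq_empty_of_forall_notMem ?_
  rintro y ⟨⟨hy, hyc⟩, hyb⟩
  have hyd : ‖y - x₀‖ < r / (16 * n) := by
    rw [mem_ball, dist_eq_norm] at hyb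
    refine hyb.trans_eq ?_
    rw [hr, ← add_assoc]
    field_simp
    norm_num
  have hyr : y ∈ closedBall x₀ r := by
    rw [mem_closedBall, dist_eq_norm]
    exact hyd.le.trans (div_le_self hr₀.le (by linarith))
  have henv := Rooftop.envelope_le_of_harmonic hr₀ hsub hh hbd hyr
  rw [hyc, EReal.coe_le_coe_iff, inner_add_left, real_inner_smul_left] at henv
  have hgap := Rooftop.rooftop_gap hn' hN hP hr (norm_nonneg (y - x₀)) hyd
  have hcs := (abs_le.1 (abs_real_inner_le_norm p (y - x₀))).2
  -- The concave square only lowers the majorant, so it can be dropped at `y`.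
  have hsq : 0 ≤ 1 / (2 * (‖p‖ * r)) * inner ℝ p (y - x₀) ^ 2 := by positivity
  linarith [hlower y hy]
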